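/- Let $K$ be an algebraically closed field of characteristic $0$. All superalgebras are finite-dimensional over $K$: an associative superalgebra is a $\mathbb Z_2$-graded associative (not necessarily unital) $K$-algebra $A=A_{\bar 0}\oplus A_{\bar 1}$ with $A_\alpha A_\beta\subseteq A_{\alpha+\beta}$. It is simple if its product is not identically zero and its only graded two-sided ideals are $\{0\}$ and $A$; it is supercommutative if $xy=(-1)^{|x||y|}yx$ for all homogeneous $x,y$. Isomorphisms are bijective $K$-linear multiplicative maps that preserve the grading. An even-symmetric structure on $A$ is a bilinear form $B:A\times A\to K$ that is even ($B(A_{\bar 0},A_{\bar 1})=B(A_{\bar 1},A_{\bar 0})=\{0\}$), supersymmetric ($B(x,y)=(-1)^{|x||y|}B(y,x)$ for homogeneous $x,y$), associative ($B(xy,z)=B(x,yz)$) and non-degenerate. For $r\ge 1$ and $s\ge 0$ let $M_{r,s}(K)$ be the algebra of square matrices of order $r+s$ whose even part consists of the block matrices $\begin{pmatrix}a&0\\0&b\end{pmatrix}$ and whose odd part consists of the block matrices $\begin{pmatrix}0&c\\d&0\end{pmatrix}$, with $a\in M_r(K)$, $b\in M_s(K)$, $c\in M_{r\times s}(K)$,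 $d\in M_{s\times r}(K)$. For $n\ge 1$ let $Q_n(K)$ be the sub-superalgebra of $M_{n,n}(K)$ with even part $\left\{\begin{pmatrix}a&0\\0&a\end{pmatrix}\right\}$ and odd part $\left\{\begin{pmatrix}0&b\\b&0\end{pmatrix}\right\}$, $a,b\in M_n(K)$. Then: 1. For all $r\ge1$, $s\ge0$, $M_{r,s}(K)$ is a simple associative superalgebra, and the bilinear form given by $$B\left(\begin{pmatrix}a&c\\d&b\end{pmatrix},\begin{pmatrix}a'&c'\\d'&b'\end{pmatrix}\right)=\operatorname{tr}(aa')-\operatorname{tr}(bb')+\operatorname{tr}(cd')-\operatorname{tr}(dc')$$ is an even-symmetric structure on it. 2. An associative superalgebra is simple and admits an even-symmetric structure if and only if it is isomorphic to $M_{r,s}(K)$ for some $r\ge 1$ and $s\ge 0$. 3. For every $n\ge 1$, the superalgebra $Q_n(K)$ admits no even-symmetric structure. 4. The field $K$ (concentrated in even degree) is a simple supercommutative associative superalgebra that admits an even-symmetric structure, and an associative superalgebra is simple, supercommutative and admits an even-symmetric structure if and only if it is isomorphic to $K$. -/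

import Mathlib

universe u v w

namespace SuperAlg

section General

variable {K : Type u} [Field K] {A : Type v} [NonUnitalRing A] [Module K A]

/-- `A = A₀ ⊕ A₁` with `A_i A_j ⊆ A_{i+j}`. Together with the standing instances (a not necessarily
unital associative ring with a compatible `K`-module structure) this makes `A` an
associative superalgebra. -/
structure IsSuperalgebra (𝒜 : ZMod 2 → Submodule K A) : Prop where
  isInternal : DirectSum.IsInternal 𝒜
  mul_mem : ∀ (i j : ZMod 2) (x y : A), x ∈ 𝒜 i → y ∈ 𝒜 j → x * y ∈ 𝒜 (i + j)

/-- Graded two-sided ideals: two-sided ideals that are subspaces and are spanned by their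
even and odd parts. -/
structure IsGradedIdeal (𝒜 : ZMod 2 → Submodule K A) (I : Submodule K A) : Prop where
  mul_mem_left : ∀ a x : A, x ∈ I → a * x ∈ I
  mul_mem_right : ∀ a x : A, x ∈ I → x * a ∈ I
  graded : ∀ x ∈ I, ∃ x₀ ∈ I ⊓ 𝒜 0, ∃ x₁ ∈ I ⊓ 𝒜 1, x = x₀ + x₁

/-- Simple superalgebras: the product is not identically zero and the only graded two-sided
ideals are `0` and `A`. -/
structure IsSimpleSuper (𝒜 : ZMod 2 → Submodule K A) : Prop where
  product_ne_zero : ∃ x y : A, x * y ≠ 0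
  eq_bot_or_eq_top : ∀ I : Submodule K A, IsGradedIdeal 𝒜 I → I = ⊥ ∨ I = ⊤

/-- An even-symmetric structure: an even, supersymmetric, associative, non-degenerate
bilinear form. -/
structure IsEvenSymmetricStructure (𝒜 : ZMod 2 → Submodule K A)
    (B : LinearMap.BilinForm K A) : Prop where
  even : ∀ (i j : ZMod 2) (x y : A), x ∈ 𝒜 i → y ∈ 𝒜 j → i + j ≠ 0 → B x y = 0
  supersymmetric : ∀ (i j : ZMod 2) (x y : A), x ∈ 𝒜 i → y ∈ 𝒜 j →
    B x y = (-1) ^ (i.val * j.val) * B y x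
  associative : ∀ x y z : A, B (x * y) z = B x (y * z)
  nondegenerate : ∀ x : A, (∀ y : A, B x y = 0) → x = 0

def AdmitsEvenSymmetric (𝒜 : ZMod 2 → Submodule K A) : Prop :=
  ∃ B : LinearMap.BilinForm K A, IsEvenSymmetricStructure 𝒜 B

def IsSupercommutative (𝒜 : ZMod 2 → Submodule K A) : Prop :=
  ∀ (i j : ZMod 2) (x y : A), x ∈ 𝒜 i → y ∈ 𝒜 j →
    x * y = (-1 : K) ^ (i.val * j.val) • (y * x)

/-- Isomorphism of superalgebras: a bijective `K`-linear multiplicative map preserving degrees. -/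
def SuperIso (𝒜 : ZMod 2 → Submodule K A) {A' : Type w} [NonUnitalRing A'] [Module K A']
    (𝒜' : ZMod 2 → Submodule K A') : Prop :=
  ∃ f : A →ₙₐ[K] A', Function.Bijective f ∧ ∀ (i : ZMod 2) (x : A), f x ∈ 𝒜' i ↔ x ∈ 𝒜 i

end General

section Examples

variable (K : Type u) [Field K]

/-- `K` viewed as a superalgebra concentrated in degree `0`. -/
def fieldGrading (i : ZMod 2) : Submodule K K := if i = 0 then ⊤ else ⊥

def matEven (r s : ℕ) : Submodule K (Matrix (Fin r ⊕ Fin s) (Fin r ⊕ Fin s) K) where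
  carrier := {X | ∃ (a : Matrix (Fin r) (Fin r) K) (b : Matrix (Fin s) (Fin s) K),
    X = Matrix.fromBlocks a 0 0 b}
  add_mem' := by
    rintro _ _ ⟨a, b, rfl⟩ ⟨a', b', rfl⟩
    exact ⟨a + a', b + b', by simp [Matrix.fromBlocks_add]⟩
  zero_mem' := ⟨0, 0, by simp⟩
  smul_mem' := by
    rintro k _ ⟨a, b, rfl⟩
    exact ⟨k • a, k • b, by simp [Matrix.fromBlocks_smul]⟩

def matOdd (r s : ℕ) : Submodule K (Matrix (Fin r ⊕ Fin s) (Fin r ⊕ Fin s) K) where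
  carrier := {X | ∃ (c : Matrix (Fin r) (Fin s) K) (d : Matrix (Fin s) (Fin r) K),
    X = Matrix.fromBlocks 0 c d 0}
  add_mem' := by
    rintro _ _ ⟨a, b, rfl⟩ ⟨a', b', rfl⟩
    exact ⟨a + a', b + b', by simp [Matrix.fromBlocks_add]⟩
  zero_mem' := ⟨0, 0, by simp⟩
  smul_mem' := by
    rintro k _ ⟨a, b, rfl⟩
    exact ⟨k • a, k • b, by simp [Matrix.fromBlocks_smul]⟩

/-- The superalgebra `M_{r,s}(K)`: all matrices of order `r + s`, with the block grading. -/
def matGrading (r s : ℕ) (i : ZMod 2) : Submodule K (Matrix (Fin r ⊕ Fin s) (Fin r ⊕ Fin s) K) :=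
  if i = 0 then matEven K r s else matOdd K r s

/-- The underlying algebra of `Q_n(K)`: matrices of the form `(a, b; b, a)`. -/
def queer (n : ℕ) : NonUnitalSubalgebra K (Matrix (Fin n ⊕ Fin n) (Fin n ⊕ Fin n) K) where
  carrier := {X | ∃ a b : Matrix (Fin n) (Fin n) K, X = Matrix.fromBlocks a b b a}
  add_mem' := by
    rintro _ _ ⟨a, b, rfl⟩ ⟨a', b', rfl⟩
    exact ⟨a + a', b + b', by simp [Matrix.fromBlocks_add]⟩
  zero_mem' := ⟨0, 0, by simp⟩
  mul_mem' := by
    rintro _ _ ⟨a, b, rfl⟩ ⟨a', b', rfl⟩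
    exact ⟨a * a' + b * b', a * b' + b * a', by
      simp [Matrix.fromBlocks_multiply, add_comm]⟩
  smul_mem' := by
    rintro k _ ⟨a, b, rfl⟩
    exact ⟨k • a, k • b, by simp [Matrix.fromBlocks_smul]⟩

/-- The grading of `Q_n(K)` as a sub-superalgebra of `M_{n,n}(K)`: the even elements are
`(a, 0; 0, a)` and the odd elements are `(0, b; b, 0)`. -/
def queerGrading (n : ℕ) (i : ZMod 2) : Submodule K (queer K n) :=
  (matGrading K n n i).comap (queer K n).toSubmodule.subtype

/-- The form on `M_{r,s}(K)` equal to `tr(aa') - tr(bb')` on the even part, to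
`tr(cd') - tr(dc')` on the odd part, and to `0` between parts of different parity, where
`X = (a, c; d, b)` and `X' = (a', c'; d', b')`. -/
def superTraceForm (r s : ℕ) :
    LinearMap.BilinForm K (Matrix (Fin r ⊕ Fin s) (Fin r ⊕ Fin s) K) :=
  LinearMap.mk₂ K
    (fun X X' =>
      ((X.toBlocks₁₁ * X'.toBlocks₁₁).trace - (X.toBlocks₂₂ * X'.toBlocks₂₂).trace) +
      ((X.toBlocks₁₂ * X'.toBlocks₂₁).trace - (X.toBlocks₂₁ * X'.toBlocks₁₂).trace))
    (by
      intro X Y Z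
      simp only [Matrix.trace, Matrix.diag, Matrix.mul_apply, Matrix.toBlocks₁₁,
        Matrix.toBlocks₁₂, Matrix.toBlocks₂₁, Matrix.toBlocks₂₂, Matrix.of_apply,
        Matrix.add_apply, add_mul, Finset.sum_add_distrib]
      ring)
    (by
      intro k X Y
      simp only [Matrix.trace, Matrix.diag, Matrix.mul_apply, Matrix.toBlocks₁₁,
        Matrix.toBlocks₁₂, Matrix.toBlocks₂₁, Matrix.toBlocks₂₂, Matrix.of_apply,
        Matrix.smul_apply, smul_eq_mul, mul_assoc, ← Finset.mul_sum]
      ring)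
    (by
      intro X Y Z
      simp only [Matrix.trace, Matrix.diag, Matrix.mul_apply, Matrix.toBlocks₁₁,
        Matrix.toBlocks₁₂, Matrix.toBlocks₂₁, Matrix.toBlocks₂₂, Matrix.of_apply,
        Matrix.add_apply, mul_add, Finset.sum_add_distrib]
      ring)
    (by
      intro k X Y
      simp only [Matrix.trace, Matrix.diag, Matrix.mul_apply, Matrix.toBlocks₁₁,
        Matrix.toBlocks₁₂, Matrix.toBlocks₂₁, Matrix.toBlocks₂₂, Matrix.of_apply,
        Matrix.smul_apply, smul_eq_mul, mul_left_comm _ k, ← Finset.mul_sum]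
      ring)

end Examples

end SuperAlg

/-! The crux is that a simple superalgebra $A$ with an even-symmetric form $B$ has no proper nonzero
two-sided ideal, graded or not. Let $\sigma$ be the parity automorphism. If $I$ were such an ideal,
then $I\cap\sigma I$ and $I+\sigma I$ would be graded, so $A=I\oplus\sigma I$. The map $\tau$ equal
to $1$ on $I$ and $-1$ on $\sigma I$ commutes with all multiplications, is odd and is self-adjoint
for $B$. But $B$ is symmetric on even elements and antisymmetric on odd ones, so moving $\tau$
across $B$ on odd arguments yields $B(\tau x,y)=-B(\tau x,y)$, contradicting nondegeneracy
(`IsEvenSymmetricStructure.eq_zero_of_odd_involution`). The same lemma excludes $Q_n$, whose element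
$(0,1;1,0)$ is an odd central involution.

Wedderburn's theorem then gives $A\cong\operatorname{End} W$. There $\sigma$ is conjugation by some
$T$, which can be scaled so that $T^2=1$; an eigenbasis of $T$ identifies $A$ with $M_{r,s}$.
Supercommutativity leaves only $M_{1,0}\cong K$. -/

namespace SuperAlg

/-! ### Wedderburn's theorem without a unit -/

section Classification

/-- **Burnside's theorem**: an algebra acting irreducibly on a finite-dimensional space over an
algebraically closed field surjects onto all linear endomorphisms. -/
theorem exists_smul_eq_of_isSimpleModule {K R V : Type*} [Field K] [IsAlgClosed K] [Ring R]
    [Algebra K R] [AddCommGroup V] [Module K V] [Module R V] [IsScalarTower K R V]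
    [FiniteDimensional K V] [IsSimpleModule R V] (f : Module.End K V) :
    ∃ r : R, ∀ v, f v = r • v := by
  have hs := (IsSimpleModule.algebraMap_end_bijective_of_isAlgClosed (A := R) (V := V) K).2
  -- By Schur's lemma the commutant is $K$, so $f$ is linear over it and Jacobson density applies;
  -- agreement on a finite spanning set is enough.
  let g : Module.End (Module.End R V) V :=
    { toFun := f
      map_add' := map_add f
      map_smul' := by
        intro e v
        obtain ⟨c, rfl⟩ := hs e
        simp }
  obtain ⟨s, hs⟩ := (Module.Finite.fg_top : (⊤ : Submodule K V).FG)
  obtain ⟨r, hr⟩ := jacobson_density (R := R) g s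
  refine ⟨r, fun v => ?_⟩
  have hv : v ∈ Submodule.span K (s : Set V) := hs ▸ Submodule.mem_top
  induction hv using Submodule.span_induction with
  | mem m hm => exact hr m hm
  | zero => simp
  | add x y _ _ hx hy => rw [map_add, hx, hy, smul_add]
  | smul c x _ hx => rw [map_smul, hx, smul_algebra_smul_comm]

theorem isSimpleRing_end (K V : Type*) [Field K] [AddCommGroup V] [Module K V]
    [FiniteDimensional K V] [Nontrivial V] : IsSimpleRing (Module.End K V) := by
  have : Nonempty (Fin (Module.finrank K V)) := Fin.pos_iff_nonempty.1 Module.finrank_pos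
  exact IsSimpleRing.of_ringEquiv
    (LinearMap.toMatrixAlgEquiv (Module.finBasis K V)).symm.toRingEquiv inferInstance

/-- In a simple ring, an additive subgroup that is closed under multiplication on both sides and
contains a nonzero element is everything. -/
theorem mem_of_isSimpleRing {R : Type*} [Ring R] [IsSimpleRing R] (I : AddSubgroup R)
    (hl : ∀ x y, y ∈ I → x * y ∈ I) (hr : ∀ x y, x ∈ I → x * y ∈ I) (hI : I ≠ ⊥) (x : R) :
    x ∈ I := by
  let J : TwoSidedIdeal R := TwoSidedIdeal.mk' (I : Set R) I.zero_mem I.add_mem I.neg_mem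
    (fun {x y} h => hl x y h) (fun {x y} h => hr x y h)
  have hJ : ∀ x, x ∈ J ↔ x ∈ I := fun x =>
    TwoSidedIdeal.mem_mk' (I : Set R) I.zero_mem I.add_mem I.neg_mem _ _ x
  rcases eq_bot_or_eq_top J with h | h
  · exact (hI ((AddSubgroup.eq_bot_iff_forall _).2 fun y hy => by
      simpa [h] using (hJ y).2 hy)).elim
  · exact (hJ x).1 (h ▸ trivial)

theorem exists_minimal_left_ideal {K : Type u} [Field K] {A : Type v} [NonUnitalRing A]
    [Module K A] [FiniteDimensional K A] [Nontrivial A] :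
    ∃ W : Submodule K A, W ≠ ⊥ ∧ (∀ a x : A, x ∈ W → a * x ∈ W) ∧
      ∀ U : Submodule K A, U ≤ W → (∀ a x : A, x ∈ U → a * x ∈ U) → U = ⊥ ∨ U = W := by
  obtain ⟨W, ⟨hW, hl⟩, hmin⟩ := WellFounded.has_min
    (wellFounded_lt (α := Submodule K A))
    {W | W ≠ ⊥ ∧ ∀ a x : A, x ∈ W → a * x ∈ W} ⟨⊤, top_ne_bot, fun _ _ _ => trivial⟩
  refine ⟨W, hW, hl, fun U hU hUl => ?_⟩
  by_cases h : U = ⊥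
  · exact .inl h
  · exact .inr (hU.eq_of_not_lt (hmin U ⟨h, hUl⟩))

section Nonunital

variable {K : Type u} [Field K] {A : Type v} [NonUnitalRing A] [Module K A]
  [IsScalarTower K A A] [SMulCommClass K A A]

/-- Left multiplication on a left ideal. -/
def leftMulOn (W : Submodule K A) (hW : ∀ a x : A, x ∈ W → a * x ∈ W) :
    A →ₙₐ[K] Module.End K W where
  toFun a := (LinearMap.mulLeft K a).restrict (hW a)
  map_smul' c a := by ext x; exact smul_mul_assoc c a (x : A)
  map_zero' := by ext x; simp [LinearMap.restrict_apply]
  map_add' a b := by ext x; exact add_mul a b (x : A)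
  map_mul' a b := by ext x; exact mul_assoc a b (x : A)

theorem coe_leftMulOn_apply (W : Submodule K A) (hW : ∀ a x : A, x ∈ W → a * x ∈ W) (a : A)
    (x : W) : (leftMulOn W hW a x : A) = a * x := rfl

/-- Wedderburn's theorem for algebras that are not assumed to be unital. -/
theorem exists_bijective_end_of_simple [IsAlgClosed K] [FiniteDimensional K A]
    (hne : ∃ x y : A, x * y ≠ 0)
    (hsimple : ∀ I : Submodule K A, (∀ a x : A, x ∈ I → a * x ∈ I) →
      (∀ a x : A, x ∈ I → x * a ∈ I) → I = ⊥ ∨ I = ⊤) :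
    ∃ W : Submodule K A, Nontrivial W ∧
      ∃ f : A →ₙₐ[K] Module.End K W, Function.Bijective f := by
  obtain ⟨a₀, b₀, hab⟩ := hne
  have : Nontrivial A := ⟨a₀ * b₀, 0, hab⟩
  obtain ⟨W, hW, hl, hmin⟩ := exists_minimal_left_ideal (K := K) (A := A)
  have hWn : Nontrivial W := Submodule.nontrivial_iff_ne_bot.2 hW
  let φ := leftMulOn W hl
  have hφ : ∀ a (x : W), (φ a x : A) = a * x := coe_leftMulOn_apply W hl
  -- Otherwise $W$ lies in the two-sided ideal $\{x : Ax=0\}$, which is neither $0$ (as $W\ne0$) nor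
  -- $A$ (as $a_0b_0\ne0$).
  have hker : ∃ a, φ a ≠ 0 := by
    by_contra! h
    let I : Submodule K A :=
      { carrier := {x | ∀ a : A, a * x = 0}
        add_mem' := fun {x y} hx hy a => by rw [mul_add, hx a, hy a, add_zero]
        zero_mem' := fun a => mul_zero a
        smul_mem' := fun c x hx a => by rw [mul_smul_comm, hx a, smul_zero] }
    rcases hsimple I (fun a x hx b => by rw [hx a, mul_zero])
      (fun a x hx b => by rw [← mul_assoc, hx b, zero_mul]) with hI | hI
    · refine hW (eq_bot_iff.2 fun x hx => ?_)
      rw [← hI]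
      intro a
      rw [← hφ a ⟨x, hx⟩, h a]; rfl
    · exact hab ((hI ▸ Submodule.mem_top : b₀ ∈ I) a₀)
  have hinj : Function.Injective φ := by
    let I : Submodule K A :=
      { carrier := {x | φ x = 0}
        add_mem' := fun {x y} (hx : φ x = 0) (hy : φ y = 0) => by
          change φ (x + y) = 0; rw [map_add, hx, hy, add_zero]
        zero_mem' := map_zero φ
        smul_mem' := fun c x (hx : φ x = 0) => by
          change φ (c • x) = 0; rw [map_smul, hx, smul_zero] }
    rcases hsimple I
      (fun a x (hx : φ x = 0) => by change φ (a * x) = 0; rw [map_mul, hx, mul_zero])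
      (fun a x (hx : φ x = 0) => by change φ (x * a) = 0; rw [map_mul, hx, zero_mul]) with hI | hI
    · refine (injective_iff_map_eq_zero φ).2 fun x hx => ?_
      have : x ∈ I := hx
      simpa [hI] using this
    · obtain ⟨a, ha⟩ := hker
      exact (ha (hI ▸ Submodule.mem_top : a ∈ I)).elim
  -- Burnside's theorem needs a unital algebra, so the identity is adjoined to the image of $A$. Its
  -- submodules of $W$ are left ideals of $A$, hence trivial by minimality.
  let S := (Unitization.lift φ).range
  have hS : IsSimpleModule S W := by
    refine { eq_bot_or_eq_top := fun U => ?_ }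
    let U' : Submodule K A := (U.restrictScalars K).map W.subtype
    have hU' : U' ≤ W := by
      rintro _ ⟨x, _, rfl⟩
      exact x.2
    have hmem : ∀ x : W, (x : A) ∈ U' ↔ x ∈ U := fun x =>
      ⟨fun ⟨y, hy, hyx⟩ => (Subtype.ext hyx : y = x) ▸ hy, fun h => ⟨x, h, rfl⟩⟩
    rcases hmin U' hU' (by
      rintro a _ ⟨x, hx, rfl⟩
      refine ⟨φ a x, ?_, hφ a x⟩
      exact U.smul_mem (⟨φ a, (a : Unitization K A), by simp⟩ : S) hx) with h | h
    · left
      refine (Submodule.eq_bot_iff _).2 fun x hx => ?_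
      have := (hmem x).2 hx
      rw [h] at this
      exact Subtype.ext this
    · right
      exact (Submodule.eq_top_iff').2 fun x => (hmem x).1 (h.ge x.2)
  have hdense (g : Module.End K W) : ∃ (c : K) (a : A), g = c • 1 + φ a := by
    obtain ⟨s, hr⟩ := exists_smul_eq_of_isSimpleModule (R := S) g
    obtain ⟨r, hs⟩ := s.2
    refine ⟨r.fst, r.snd, ?_⟩
    ext1 v
    rw [hr v, ← Algebra.algebraMap_eq_smul_one]
    change (s : Module.End K W) v = _
    rw [← hs]
    rfl
  have := isSimpleRing_end K W
  refine ⟨W, hWn, φ, hinj, fun g => ?_⟩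
  -- Since every endomorphism is a scalar plus some $\varphi(a)$, the image of $\varphi$ is a
  -- two-sided ideal of the simple ring $\operatorname{End} W$.
  refine mem_of_isSimpleRing (R := Module.End K W) ((φ : A →+ Module.End K W).range) ?_ ?_ ?_ g
  · rintro x _ ⟨b, rfl⟩
    obtain ⟨c, a, rfl⟩ := hdense x
    exact ⟨c • b + a * b, by simp [add_mul]⟩
  · rintro _ x ⟨b, rfl⟩
    obtain ⟨c, a, rfl⟩ := hdense x
    exact ⟨c • b + b * a, by simp [mul_add]⟩
  · intro h
    obtain ⟨a, ha⟩ := hker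
    exact ha ((AddSubgroup.eq_bot_iff_forall _).1 h _ ⟨a, rfl⟩)

end Nonunital

end Classification

/-! ### The parity involution and even-symmetric forms -/

section Parity

variable {K : Type u} [Field K] {A : Type v} [NonUnitalRing A] [Module K A]
  {𝒜 : ZMod 2 → Submodule K A}

theorem isInternal_iff_isCompl : DirectSum.IsInternal 𝒜 ↔ IsCompl (𝒜 0) (𝒜 1) :=
  DirectSum.isInternal_submodule_iff_isCompl 𝒜 (by decide) (by
    refine (Set.eq_univ_of_forall fun i => ?_).symm
    fin_cases i
    · exact .inl rfl
    · exact .inr rfl)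

theorem IsSuperalgebra.isCompl (h : IsSuperalgebra 𝒜) : IsCompl (𝒜 0) (𝒜 1) :=
  isInternal_iff_isCompl.1 h.isInternal

theorem IsSuperalgebra.exists_add (h : IsSuperalgebra 𝒜) (x : A) :
    ∃ x₀ ∈ 𝒜 0, ∃ x₁ ∈ 𝒜 1, x₀ + x₁ = x :=
  Submodule.mem_sup.1 (h.isCompl.sup_eq_top ▸ Submodule.mem_top)

/-- The parity involution `x₀ + x₁ ↦ x₀ - x₁`. -/
noncomputable def parity (h : IsSuperalgebra 𝒜) : A →ₗ[K] A :=
  LinearMap.ofIsCompl h.isCompl (𝒜 0).subtype (-(𝒜 1).subtype)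

theorem parity_even (h : IsSuperalgebra 𝒜) {x : A} (hx : x ∈ 𝒜 0) : parity h x = x :=
  LinearMap.ofIsCompl_apply_left h.isCompl ⟨x, hx⟩

theorem parity_odd (h : IsSuperalgebra 𝒜) {x : A} (hx : x ∈ 𝒜 1) : parity h x = -x :=
  LinearMap.ofIsCompl_apply_right h.isCompl ⟨x, hx⟩

theorem parity_parity (h : IsSuperalgebra 𝒜) (x : A) : parity h (parity h x) = x := by
  obtain ⟨x₀, h₀, x₁, h₁, rfl⟩ := h.exists_add x
  simp [parity_even h h₀, parity_odd h h₁]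

theorem parity_mul (h : IsSuperalgebra 𝒜) (x y : A) :
    parity h (x * y) = parity h x * parity h y := by
  obtain ⟨x₀, hx₀, x₁, hx₁, rfl⟩ := h.exists_add x
  obtain ⟨y₀, hy₀, y₁, hy₁, rfl⟩ := h.exists_add y
  have h₀₀ : x₀ * y₀ ∈ 𝒜 0 := h.mul_mem 0 0 _ _ hx₀ hy₀
  have h₀₁ : x₀ * y₁ ∈ 𝒜 1 := h.mul_mem 0 1 _ _ hx₀ hy₁
  have h₁₀ : x₁ * y₀ ∈ 𝒜 1 := h.mul_mem 1 0 _ _ hx₁ hy₀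
  have h₁₁ : x₁ * y₁ ∈ 𝒜 0 := h.mul_mem 1 1 _ _ hx₁ hy₁
  simp only [add_mul, mul_add, map_add, parity_even h hx₀, parity_odd h hx₁, parity_even h hy₀,
    parity_odd h hy₁, parity_even h h₀₀, parity_even h h₁₁, parity_odd h h₀₁, parity_odd h h₁₀,
    neg_mul, mul_neg]
  abel

/-- An even form is invariant under the parity involution. -/
theorem IsEvenSymmetricStructure.parity_parity {B : LinearMap.BilinForm K A}
    (hB : IsEvenSymmetricStructure 𝒜 B) (h : IsSuperalgebra 𝒜) (x y : A) :
    B (parity h x) (parity h y) = B x y := by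
  obtain ⟨x₀, hx₀, x₁, hx₁, rfl⟩ := h.exists_add x
  obtain ⟨y₀, hy₀, y₁, hy₁, rfl⟩ := h.exists_add y
  have h₀₁ := hB.even 0 1 _ _ hx₀ hy₁ (by decide)
  have h₁₀ := hB.even 1 0 _ _ hx₁ hy₀ (by decide)
  simp [parity_even h hx₀, parity_odd h hx₁, parity_even h hy₀, parity_odd h hy₁, h₀₁, h₁₀]

variable [CharZero K]

theorem eq_zero_of_eq_neg_self {M : Type*} [AddCommGroup M] [Module K M] {x : M} (h : x = -x) :
    x = 0 := by
  have h2 : (2 : K) • x = 0 := by rw [two_smul]; nth_rw 2 [h]; exact add_neg_cancel x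
  exact (smul_eq_zero.1 h2).resolve_left two_ne_zero

theorem mem_zero_iff_parity (h : IsSuperalgebra 𝒜) (x : A) : x ∈ 𝒜 0 ↔ parity h x = x := by
  refine ⟨parity_even h, fun hx => ?_⟩
  obtain ⟨x₀, h₀, x₁, h₁, rfl⟩ := h.exists_add x
  rw [map_add, parity_even h h₀, parity_odd h h₁, add_right_inj] at hx
  rwa [eq_zero_of_eq_neg_self (K := K) hx.symm, add_zero]

theorem mem_one_iff_parity (h : IsSuperalgebra 𝒜) (x : A) : x ∈ 𝒜 1 ↔ parity h x = -x := by
  refine ⟨parity_odd h, fun hx => ?_⟩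
  obtain ⟨x₀, h₀, x₁, h₁, rfl⟩ := h.exists_add x
  rw [map_add, parity_even h h₀, parity_odd h h₁, neg_add, add_left_inj] at hx
  rwa [eq_zero_of_eq_neg_self (K := K) hx, zero_add]

/-- The homogeneous components of $x$ are $(x\pm\sigma x)/2$, where $\sigma$ is the parity. -/
theorem isGradedIdeal_of_parity_mem (h : IsSuperalgebra 𝒜) {I : Submodule K A}
    (hl : ∀ a x : A, x ∈ I → a * x ∈ I) (hr : ∀ a x : A, x ∈ I → x * a ∈ I)
    (hσ : ∀ x ∈ I, parity h x ∈ I) : IsGradedIdeal 𝒜 I where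
  mul_mem_left := hl
  mul_mem_right := hr
  graded x hx := by
    refine ⟨(2⁻¹ : K) • (x + parity h x), ⟨I.smul_mem _ (I.add_mem hx (hσ x hx)), ?_⟩,
      (2⁻¹ : K) • (x - parity h x), ⟨I.smul_mem _ (I.sub_mem hx (hσ x hx)), ?_⟩, ?_⟩
    · refine (mem_zero_iff_parity h _).2 ?_
      rw [map_smul, map_add, parity_parity, add_comm]
    · refine (mem_one_iff_parity h _).2 ?_
      rw [map_smul, map_sub, parity_parity, ← smul_neg, neg_sub]
    · rw [← smul_add, add_add_sub_cancel, ← two_smul K x, smul_smul, inv_mul_cancel₀ two_ne_zero,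
        one_smul]

/-- An odd involution that is self-adjoint for an even-symmetric structure forces the even part to
vanish. -/
theorem IsEvenSymmetricStructure.eq_zero_of_odd_involution {B : LinearMap.BilinForm K A}
    (hB : IsEvenSymmetricStructure 𝒜 B) (h : IsSuperalgebra 𝒜) (τ : A → A)
    (hτ₀ : ∀ x ∈ 𝒜 0, τ x ∈ 𝒜 1) (hτ₁ : ∀ x ∈ 𝒜 1, τ x ∈ 𝒜 0) (hτ : ∀ x, τ (τ x) = x)
    (h0 : τ 0 = 0) (hadj : ∀ x y, B (τ x) y = B x (τ y)) {x : A} (hx : x ∈ 𝒜 0) : x = 0 := by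
  rw [← hτ x, ← h0]
  congr 1
  -- It suffices that the odd element $\tau x$ is in the radical. Even $y$ pair to zero with it; for
  -- odd $y$ the swap of $\tau x$ and $y$ costs a sign, while the swap of the even $\tau y$ and $x$
  -- does not.
  refine hB.nondegenerate _ fun y => ?_
  obtain ⟨y₀, hy₀, y₁, hy₁, rfl⟩ := h.exists_add y
  have e₀ : B (τ x) y₀ = 0 := hB.even 1 0 _ _ (hτ₀ x hx) hy₀ (by decide)
  have e₁ : B (τ x) y₁ = -B (τ x) y₁ := calc
    B (τ x) y₁ = -B y₁ (τ x) := by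
      simpa [ZMod.val_one] using hB.supersymmetric 1 1 _ _ (hτ₀ x hx) hy₁
    _ = -B (τ y₁) x := by rw [hadj]
    _ = -B x (τ y₁) := by rw [hB.supersymmetric 0 0 _ _ (hτ₁ _ hy₁) hx]; simp
    _ = -B (τ x) y₁ := by rw [hadj]
  rw [map_add, e₀, eq_zero_of_eq_neg_self (K := K) e₁, add_zero]

/-- A simple superalgebra with an even-symmetric structure is simple as an ungraded algebra. -/
theorem IsSimpleSuper.eq_bot_or_eq_top_of_evenSymmetric (hs : IsSimpleSuper 𝒜)
    (h : IsSuperalgebra 𝒜) {B : LinearMap.BilinForm K A} (hB : IsEvenSymmetricStructure 𝒜 B)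
    (I : Submodule K A) (hl : ∀ a x : A, x ∈ I → a * x ∈ I)
    (hr : ∀ a x : A, x ∈ I → x * a ∈ I) : I = ⊥ ∨ I = ⊤ := by
  by_contra! hI
  let J := I.comap (parity h)
  have hJ : ∀ x, x ∈ J ↔ parity h x ∈ I := fun x => Iff.rfl
  have hJσ : ∀ x ∈ I, parity h x ∈ J := fun x hx => by rwa [hJ, parity_parity]
  have hJl : ∀ a x : A, x ∈ J → a * x ∈ J := fun a x hx => by
    rw [hJ, parity_mul]; exact hl _ _ hx
  have hJr : ∀ a x : A, x ∈ J → x * a ∈ J := fun a x hx => by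
    rw [hJ, parity_mul]; exact hr _ _ hx
  -- Parity exchanges $I$ and $J$, so their intersection and their sum are graded ideals.
  have hcompl : IsCompl I J := by
    constructor
    · rw [disjoint_iff]
      refine (hs.eq_bot_or_eq_top _ (isGradedIdeal_of_parity_mem h ?_ ?_ ?_)).resolve_right ?_
      · exact fun a x hx => ⟨hl a x hx.1, hJl a x hx.2⟩
      · exact fun a x hx => ⟨hr a x hx.1, hJr a x hx.2⟩
      · exact fun x hx => ⟨hx.2, hJσ x hx.1⟩
      · exact fun e => hI.2 (inf_eq_top_iff.1 e).1
    · rw [codisjoint_iff]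
      refine (hs.eq_bot_or_eq_top _ (isGradedIdeal_of_parity_mem h ?_ ?_ ?_)).resolve_left ?_
      · intro a x hx
        obtain ⟨y, hy, z, hz, rfl⟩ := Submodule.mem_sup.1 hx
        rw [mul_add]
        exact Submodule.add_mem_sup (hl a y hy) (hJl a z hz)
      · intro a x hx
        obtain ⟨y, hy, z, hz, rfl⟩ := Submodule.mem_sup.1 hx
        rw [add_mul]
        exact Submodule.add_mem_sup (hr a y hy) (hJr a z hz)
      · intro x hx
        obtain ⟨y, hy, z, hz, rfl⟩ := Submodule.mem_sup.1 hx
        rw [map_add, add_comm]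
        exact Submodule.add_mem_sup hz (hJσ y hy)
      · exact fun e => hI.1 (sup_eq_bot_iff.1 e).1
  let τ : A →ₗ[K] A := LinearMap.ofIsCompl hcompl I.subtype (-J.subtype)
  have τI : ∀ x ∈ I, τ x = x := fun x hx => LinearMap.ofIsCompl_apply_left hcompl ⟨x, hx⟩
  have τJ : ∀ x ∈ J, τ x = -x := fun x hx => LinearMap.ofIsCompl_apply_right hcompl ⟨x, hx⟩
  have hadd : ∀ x : A, ∃ y ∈ I, ∃ z ∈ J, y + z = x := fun x =>
    Submodule.mem_sup.1 (hcompl.sup_eq_top ▸ Submodule.mem_top)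
  have hττ : ∀ x, τ (τ x) = x := by
    intro x
    obtain ⟨y, hy, z, hz, rfl⟩ := hadd x
    simp [τI y hy, τJ z hz]
  -- Since parity swaps the two eigenspaces of $\tau$, it anticommutes with $\tau$; hence $\tau$ is
  -- odd.
  have hτσ : ∀ x, τ (parity h x) = -parity h (τ x) := by
    intro x
    obtain ⟨y, hy, z, hz, rfl⟩ := hadd x
    rw [map_add, map_add, map_add, τI y hy, τJ z hz, τI _ hz, τJ _ (hJσ y hy), map_add, map_neg]
    abel
  have hτl : ∀ x y, τ (x * y) = x * τ y := by
    intro x y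
    obtain ⟨y, hy, z, hz, rfl⟩ := hadd y
    rw [mul_add, map_add, map_add, τI y hy, τJ z hz, τI _ (hl x y hy), τJ _ (hJl x z hz), mul_add,
      mul_neg]
  have hτr : ∀ x y, τ (x * y) = τ x * y := by
    intro x a
    obtain ⟨y, hy, z, hz, rfl⟩ := hadd x
    rw [add_mul, map_add, map_add, τI y hy, τJ z hz, τI _ (hr a y hy), τJ _ (hJr a z hz), add_mul,
      neg_mul]
  have hτ₀ : ∀ x ∈ 𝒜 0, τ x ∈ 𝒜 1 := fun x hx => by
    rw [mem_one_iff_parity h, ← neg_eq_iff_eq_neg, ← hτσ, parity_even h hx]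
  have hτ₁ : ∀ x ∈ 𝒜 1, τ x ∈ 𝒜 0 := fun x hx => by
    rw [mem_zero_iff_parity h, ← neg_inj, ← hτσ, parity_odd h hx, map_neg]
  have hprod : ∀ x y z, B (τ (x * y)) z = B (x * y) (τ z) := fun x y z => by
    rw [hτl, hB.associative, ← hτr, hτl, hB.associative]
  -- Self-adjointness is known only on products, and $A$ has no unit a priori. The set where it
  -- holds contains every product, so it is automatically an ideal, and it is nonzero; simplicity
  -- makes it all of $A$.
  let N : Submodule K A :=
    { carrier := {p | ∀ z, B (τ p) z = B p (τ z)}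
      add_mem' := fun {p q} hp hq z => by
        simp only [map_add, LinearMap.add_apply, hp z, hq z]
      zero_mem' := fun z => by simp
      smul_mem' := fun c p hp z => by simp only [map_smul, LinearMap.smul_apply, hp z] }
  have hN : IsGradedIdeal 𝒜 N := by
    refine isGradedIdeal_of_parity_mem h (fun a x _ => hprod a x) (fun a x _ => hprod x a)
      fun p hp z => ?_
    have e : ∀ a b, B (parity h a) b = B a (parity h b) := fun a b => by
      rw [← hB.parity_parity h, parity_parity]
    rw [hτσ, e, map_neg, LinearMap.neg_apply, e, hp, hτσ, map_neg, neg_neg]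
  obtain ⟨a, b, hab⟩ := hs.product_ne_zero
  have hNtop : N = ⊤ := by
    refine (hs.eq_bot_or_eq_top N hN).resolve_left fun e => hab ?_
    have : a * b ∈ N := hprod a b
    simpa [e] using this
  have hadj : ∀ x y, B (τ x) y = B x (τ y) := fun x => (hNtop ▸ Submodule.mem_top : x ∈ N)
  have hzero : ∀ x ∈ 𝒜 0, x = 0 := fun x hx =>
    hB.eq_zero_of_odd_involution h τ hτ₀ hτ₁ hττ (map_zero τ) hadj hx
  have hall : ∀ x : A, x = 0 := by
    intro x
    obtain ⟨x₀, h₀, x₁, h₁, rfl⟩ := h.exists_add x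
    rw [hzero x₀ h₀, zero_add, ← hττ x₁, hzero _ (hτ₁ x₁ h₁), map_zero]
  exact hab (hall _)

end Parity

/-! ### The superalgebras $M_{r,s}(K)$ and $Q_n(K)$ -/

section MatrixAlgebra

open Matrix

section Field

variable {K : Type u} [Field K] {r s : ℕ}

theorem mem_matEven_iff {X : Matrix (Fin r ⊕ Fin s) (Fin r ⊕ Fin s) K} :
    X ∈ matEven K r s ↔ X.toBlocks₁₂ = 0 ∧ X.toBlocks₂₁ = 0 := by
  constructor
  · rintro ⟨a, b, rfl⟩
    simp
  · rintro ⟨h₁, h₂⟩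
    exact ⟨X.toBlocks₁₁, X.toBlocks₂₂, by
      conv_lhs => rw [← fromBlocks_toBlocks X, h₁, h₂]⟩

theorem mem_matOdd_iff {X : Matrix (Fin r ⊕ Fin s) (Fin r ⊕ Fin s) K} :
    X ∈ matOdd K r s ↔ X.toBlocks₁₁ = 0 ∧ X.toBlocks₂₂ = 0 := by
  constructor
  · rintro ⟨a, b, rfl⟩
    simp
  · rintro ⟨h₁, h₂⟩
    exact ⟨X.toBlocks₁₂, X.toBlocks₂₁, by
      conv_lhs => rw [← fromBlocks_toBlocks X, h₁, h₂]⟩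

theorem matGrading_zero : matGrading K r s 0 = matEven K r s := rfl

theorem matGrading_one : matGrading K r s 1 = matOdd K r s := rfl

theorem isCompl_matEven_matOdd : IsCompl (matEven K r s) (matOdd K r s) := by
  constructor
  · rw [Submodule.disjoint_def]
    intro X h₀ h₁
    rw [mem_matEven_iff] at h₀
    rw [mem_matOdd_iff] at h₁
    rw [← fromBlocks_toBlocks X, h₀.1, h₀.2, h₁.1, h₁.2, fromBlocks_zero]
  · rw [codisjoint_iff, Submodule.eq_top_iff']
    intro X
    rw [Submodule.mem_sup]
    exact ⟨_, ⟨X.toBlocks₁₁, X.toBlocks₂₂, rfl⟩, _, ⟨X.toBlocks₁₂, X.toBlocks₂₁, rfl⟩, by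
      simp [fromBlocks_add, fromBlocks_toBlocks]⟩

theorem isSuperalgebra_matGrading : IsSuperalgebra (matGrading K r s) where
  isInternal := isInternal_iff_isCompl.2 isCompl_matEven_matOdd
  mul_mem i j X Y hX hY := by
    fin_cases i <;> fin_cases j
    · obtain ⟨a, b, rfl⟩ := hX
      obtain ⟨a', b', rfl⟩ := hY
      exact ⟨a * a', b * b', by simp [fromBlocks_multiply]⟩
    · obtain ⟨a, b, rfl⟩ := hX
      obtain ⟨c, d, rfl⟩ := hY
      exact ⟨a * c, b * d, by simp [fromBlocks_multiply]⟩
    · obtain ⟨c, d, rfl⟩ := hX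
      obtain ⟨a, b, rfl⟩ := hY
      exact ⟨c * b, d * a, by simp [fromBlocks_multiply]⟩
    · obtain ⟨c, d, rfl⟩ := hX
      obtain ⟨c', d', rfl⟩ := hY
      exact ⟨c * d', d * c', by simp [fromBlocks_multiply]⟩

/-- The full matrix ring is already simple when the grading is forgotten. -/
theorem isSimpleSuper_matGrading (hr : 1 ≤ r) : IsSimpleSuper (matGrading K r s) := by
  have : Nonempty (Fin r) := ⟨⟨0, hr⟩⟩
  refine ⟨⟨1, 1, by simp⟩, fun I hI => ?_⟩
  rw [or_iff_not_imp_left]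
  intro hne
  rw [Submodule.eq_top_iff']
  refine mem_of_isSimpleRing I.toAddSubgroup hI.mul_mem_left (fun x y h => hI.mul_mem_right y x h) ?_
  intro h
  refine hne ((Submodule.eq_bot_iff _).2 ((AddSubgroup.eq_bot_iff_forall _).1 h))

/-- The grading operator `diag(1, -1)`. -/
def gradingMatrix (K : Type u) [Field K] (r s : ℕ) : Matrix (Fin r ⊕ Fin s) (Fin r ⊕ Fin s) K :=
  fromBlocks 1 0 0 (-1)

theorem gradingMatrix_mul_self : gradingMatrix K r s * gradingMatrix K r s = 1 := by
  simp [gradingMatrix, fromBlocks_multiply]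

theorem trace_fromBlocks_eq (a : Matrix (Fin r) (Fin r) K) (b : Matrix (Fin r) (Fin s) K)
    (c : Matrix (Fin s) (Fin r) K) (d : Matrix (Fin s) (Fin s) K) :
    trace (fromBlocks a b c d) = trace a + trace d := by
  simp [trace, Fintype.sum_sum_type]

/-- The form is the supertrace of $XY$. Written this way, associativity is that of the matrix
product, and nondegeneracy follows from that of the trace pairing because the grading matrix is
invertible. -/
theorem superTraceForm_eq_trace (X Y : Matrix (Fin r ⊕ Fin s) (Fin r ⊕ Fin s) K) :
    superTraceForm K r s X Y = trace (gradingMatrix K r s * X * Y) := by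
  rw [← fromBlocks_toBlocks X, ← fromBlocks_toBlocks Y]
  simp [superTraceForm, gradingMatrix, fromBlocks_multiply, trace_fromBlocks_eq]
  ring

theorem isEvenSymmetricStructure_superTraceForm :
    IsEvenSymmetricStructure (matGrading K r s) (superTraceForm K r s) where
  even i j X Y hX hY hij := by
    fin_cases i <;> fin_cases j
    · exact (hij rfl).elim
    · obtain ⟨a, b, rfl⟩ := hX
      obtain ⟨c, d, rfl⟩ := hY
      simp [superTraceForm]
    · obtain ⟨c, d, rfl⟩ := hX
      obtain ⟨a, b, rfl⟩ := hY
      simp [superTraceForm]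
    · exact (hij rfl).elim
  supersymmetric i j X Y hX hY := by
    fin_cases i <;> fin_cases j
    · obtain ⟨a, b, rfl⟩ := hX
      obtain ⟨a', b', rfl⟩ := hY
      change _ = (-1) ^ (0 * 0) * _
      simp [superTraceForm, trace_mul_comm a, trace_mul_comm b]
    · obtain ⟨a, b, rfl⟩ := hX
      obtain ⟨c, d, rfl⟩ := hY
      simp [superTraceForm]
    · obtain ⟨c, d, rfl⟩ := hX
      obtain ⟨a, b, rfl⟩ := hY
      simp [superTraceForm]
    · obtain ⟨c, d, rfl⟩ := hX
      obtain ⟨c', d', rfl⟩ := hY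
      change _ = (-1) ^ (1 * 1) * _
      simp [superTraceForm, trace_mul_comm c, trace_mul_comm d]
  associative X Y Z := by
    simp only [superTraceForm_eq_trace, Matrix.mul_assoc]
  nondegenerate X h := by
    have h0 : gradingMatrix K r s * X = 0 := by
      refine Matrix.ext_iff_trace_mul_right.2 fun Y => ?_
      rw [← superTraceForm_eq_trace, h, Matrix.zero_mul, trace_zero]
    rw [← Matrix.one_mul X, ← gradingMatrix_mul_self, Matrix.mul_assoc, h0, Matrix.mul_zero]

/-- Left multiplication by the odd central involution `(0, 1; 1, 0)` of `Q_n(K)`. -/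
def queerInvolution (K : Type u) [Field K] (n : ℕ) : queer K n :=
  ⟨fromBlocks 0 1 1 0, 0, 1, rfl⟩

theorem queerInvolution_mul_self_mul {n : ℕ} (x : queer K n) :
    queerInvolution K n * (queerInvolution K n * x) = x := by
  obtain ⟨_, a, b, rfl⟩ := x
  exact Subtype.ext (by simp [queerInvolution, fromBlocks_multiply])

theorem queerInvolution_mul_comm {n : ℕ} (x : queer K n) :
    queerInvolution K n * x = x * queerInvolution K n := by
  obtain ⟨_, a, b, rfl⟩ := x
  exact Subtype.ext (by simp [queerInvolution, fromBlocks_multiply])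

theorem isSuperalgebra_queerGrading (n : ℕ) : IsSuperalgebra (queerGrading K n) where
  isInternal := by
    refine isInternal_iff_isCompl.2 ⟨?_, ?_⟩
    · rw [Submodule.disjoint_def]
      intro x h₀ h₁
      exact Subtype.ext (Submodule.disjoint_def.1 isCompl_matEven_matOdd.disjoint _ h₀ h₁)
    · rw [codisjoint_iff, Submodule.eq_top_iff']
      rintro ⟨_, a, b, rfl⟩
      rw [Submodule.mem_sup]
      exact ⟨⟨fromBlocks a 0 0 a, a, 0, rfl⟩, ⟨a, a, rfl⟩, ⟨fromBlocks 0 b b 0, 0, b, rfl⟩,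
        ⟨b, b, rfl⟩, Subtype.ext (by simp [fromBlocks_add])⟩
  mul_mem i j x y hx hy :=
    (isSuperalgebra_matGrading (K := K) (r := n) (s := n)).mul_mem i j x.1 y.1 hx hy

theorem queerInvolution_mem (n : ℕ) : queerInvolution K n ∈ queerGrading K n 1 :=
  ⟨1, 1, rfl⟩

theorem not_admitsEvenSymmetric_queerGrading [CharZero K] {n : ℕ} (hn : 1 ≤ n) :
    ¬ AdmitsEvenSymmetric (queerGrading K n) := by
  rintro ⟨B, hB⟩
  have hQ := isSuperalgebra_queerGrading (K := K) n
  have : Nonempty (Fin n) := ⟨⟨0, hn⟩⟩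
  have hone : (⟨fromBlocks 1 0 0 1, 1, 0, rfl⟩ : queer K n) = 0 := by
    -- Centrality of the involution makes multiplication by it self-adjoint, so the even element $1$
    -- would have to vanish.
    refine hB.eq_zero_of_odd_involution hQ (fun x => queerInvolution K n * x)
      (fun x hx => hQ.mul_mem 1 0 _ _ (queerInvolution_mem n) hx)
      (fun x hx => hQ.mul_mem 1 1 _ _ (queerInvolution_mem n) hx)
      queerInvolution_mul_self_mul (mul_zero _) (fun x y => ?_) ⟨1, 1, rfl⟩
    rw [queerInvolution_mul_comm, hB.associative]
  exact one_ne_zero (fromBlocks_one.symm.trans (congrArg Subtype.val hone))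

end Field

section CharZero

variable {K : Type u} [Field K] [CharZero K] {r s : ℕ}

/-- Conjugation by the grading matrix fixes the diagonal blocks and negates the others, so it is the
parity of $M_{r,s}$. -/
theorem mem_matGrading_zero_iff {X : Matrix (Fin r ⊕ Fin s) (Fin r ⊕ Fin s) K} :
    X ∈ matGrading K r s 0 ↔ gradingMatrix K r s * X * gradingMatrix K r s = X := by
  have hn {m n : Type} (Y : Matrix m n K) : -Y = Y ↔ Y = 0 :=
    ⟨fun h => eq_zero_of_eq_neg_self (K := K) h.symm, fun h => by rw [h, neg_zero]⟩
  rw [matGrading_zero, mem_matEven_iff]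
  rw [← fromBlocks_toBlocks X]
  simp only [gradingMatrix, fromBlocks_multiply, toBlocks_fromBlocks₁₂, toBlocks_fromBlocks₂₁,
    fromBlocks_inj]
  simp [hn]

theorem mem_matGrading_one_iff {X : Matrix (Fin r ⊕ Fin s) (Fin r ⊕ Fin s) K} :
    X ∈ matGrading K r s 1 ↔ gradingMatrix K r s * X * gradingMatrix K r s = -X := by
  have hn {m n : Type} (Y : Matrix m n K) : Y = -Y ↔ Y = 0 :=
    ⟨fun h => eq_zero_of_eq_neg_self (K := K) h, fun h => by rw [h, neg_zero]⟩
  rw [matGrading_one, mem_matOdd_iff]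
  rw [← fromBlocks_toBlocks X]
  simp only [gradingMatrix, fromBlocks_multiply, toBlocks_fromBlocks₁₁, toBlocks_fromBlocks₂₂,
    fromBlocks_neg, fromBlocks_inj]
  simp [hn]

end CharZero

end MatrixAlgebra

/-! ### Involutions of a vector space and of its endomorphism algebra -/

section Involution

variable {K : Type u} [Field K] {V : Type v} [AddCommGroup V]
  [Module K V] [FiniteDimensional K V]

/-- An involutive linear automorphism, up to sign, is `diag(1, -1)` in a suitable basis. -/
theorem exists_basis_toMatrix_eq_gradingMatrix [CharZero K] [Nontrivial V] (T : Module.End K V)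
    (hT : T * T = 1) :
    ∃ (r s : ℕ) (b : Module.Basis (Fin r ⊕ Fin s) K V), 1 ≤ r ∧
      (LinearMap.toMatrixAlgEquiv b T = gradingMatrix K r s ∨
        LinearMap.toMatrixAlgEquiv b T = -gradingMatrix K r s) := by
  have key : ∀ S : Module.End K V, S * S = 1 →
      ∃ (r s : ℕ) (b : Module.Basis (Fin r ⊕ Fin s) K V),
        LinearMap.toMatrixAlgEquiv b S = gradingMatrix K r s := by
    intro S hS
    have hSS : ∀ x, S (S x) = x := fun x => LinearMap.congr_fun hS x
    let P : Submodule K V := LinearMap.ker (S - 1)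
    let N : Submodule K V := LinearMap.ker (S + 1)
    have hP : ∀ x, x ∈ P ↔ S x = x := fun x => by
      simp [P, sub_eq_zero]
    have hN : ∀ x, x ∈ N ↔ S x = -x := fun x => by
      simp [N, add_eq_zero_iff_eq_neg]
    have hc : IsCompl P N := by
      constructor
      · rw [Submodule.disjoint_def]
        intro x h₁ h₂
        rw [hP] at h₁
        rw [hN, h₁] at h₂
        exact eq_zero_of_eq_neg_self (K := K) h₂
      · rw [codisjoint_iff, Submodule.eq_top_iff']
        intro x
        refine Submodule.mem_sup.2 ⟨(2⁻¹ : K) • (x + S x), ?_, (2⁻¹ : K) • (x - S x), ?_, ?_⟩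
        · rw [hP, map_smul, map_add, hSS, add_comm]
        · rw [hN, map_smul, map_sub, hSS, ← smul_neg, neg_sub]
        · rw [← smul_add, add_add_sub_cancel, ← two_smul K x, smul_smul,
            inv_mul_cancel₀ two_ne_zero, one_smul]
    let b := ((Module.finBasis K P).prod (Module.finBasis K N)).map
      (Submodule.prodEquivOfIsCompl P N hc)
    refine ⟨_, _, b, ?_⟩
    have hl : ∀ i, b (Sum.inl i) = Module.finBasis K P i := fun i => by simp [b]
    have hr : ∀ i, b (Sum.inr i) = Module.finBasis K N i := fun i => by simp [b]
    have hSl : ∀ i, S (b (Sum.inl i)) = b (Sum.inl i) := fun i => by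
      rw [hl]; exact (hP _).1 (Module.finBasis K P i).2
    have hSr : ∀ i, S (b (Sum.inr i)) = -b (Sum.inr i) := fun i => by
      rw [hr]; exact (hN _).1 (Module.finBasis K N i).2
    ext i j
    rw [LinearMap.toMatrixAlgEquiv_apply]
    rcases j with j | j
    · rw [hSl, Module.Basis.repr_self]
      rcases i with i | i
      · simp [gradingMatrix, Matrix.one_apply, Finsupp.single_apply, @eq_comm _ i j]
      · simp [gradingMatrix]
    · rw [hSr, map_neg, Module.Basis.repr_self]
      rcases i with i | i
      · simp [gradingMatrix]
      · simp [gradingMatrix, Matrix.one_apply, Finsupp.single_apply, @eq_comm _ i j]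
  obtain ⟨r, s, b, hb⟩ := key T hT
  -- If $r=0$ then $T=-1$, and $-T$ is used instead so that $r\ge1$. If that failed as well, $1=-1$
  -- would follow.
  rcases Nat.eq_zero_or_pos r with rfl | hr
  · obtain ⟨r', s', b', hb'⟩ := key (-T) (by rw [neg_mul_neg, hT])
    refine ⟨r', s', b', ?_, .inr (by rw [← hb', map_neg, neg_neg])⟩
    by_contra! h
    obtain rfl : r' = 0 := by omega
    have hb1 : LinearMap.toMatrixAlgEquiv b T = -1 := by
      rw [hb, ← Matrix.fromBlocks_one, Matrix.fromBlocks_neg]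
      ext (i | i) (j | j)
      · exact i.elim0
      · exact i.elim0
      · exact j.elim0
      · simp [gradingMatrix]
    have hb2 : LinearMap.toMatrixAlgEquiv b' (-T) = -1 := by
      rw [hb', ← Matrix.fromBlocks_one, Matrix.fromBlocks_neg]
      ext (i | i) (j | j)
      · exact i.elim0
      · exact i.elim0
      · exact j.elim0
      · simp [gradingMatrix]
    have h1 : T = -1 := (LinearMap.toMatrixAlgEquiv b).injective (by rw [hb1, map_neg, map_one])
    have h2 : -T = -1 := (LinearMap.toMatrixAlgEquiv b').injective (by rw [hb2, map_neg, map_one])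
    rw [h1, neg_neg] at h2
    exact one_ne_zero (eq_zero_of_eq_neg_self (K := K) h2)
  · exact ⟨r, s, b, hr, .inl hb⟩

/-- An involutive automorphism of `End V` is conjugation by an involution. -/
theorem exists_involution_of_algEquiv [IsAlgClosed K] [Nontrivial V]
    (σ : Module.End K V ≃ₐ[K] Module.End K V)
    (hσ : ∀ X, σ (σ X) = X) : ∃ T : Module.End K V, T * T = 1 ∧ ∀ X, σ X = T * X * T := by
  -- Automorphisms of $\operatorname{End} V$ are inner. As $\sigma^2=1$, the square of the
  -- conjugating map is central, hence a nonzero scalar $c$; dividing by a square root of $c$ gives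
  -- an involution.
  obtain ⟨S, hS⟩ := σ.eq_linearEquivConjAlgEquiv
  let T : Module.End K V := S
  have hinv : ∀ x, S.symm (S x) = x := S.symm_apply_apply
  have hT : ∀ X, σ X * T = T * X := fun X => by
    ext x
    simp [hS, T]
  have hTT : T * T ∈ Set.center (Module.End K V) := by
    rw [Semigroup.mem_center_iff]
    intro X
    rw [← mul_assoc, ← hσ X, hT, mul_assoc, hT, ← mul_assoc, hσ]
  obtain ⟨c, _, hc⟩ := Module.End.mem_center_iff.1 hTT
  replace hc : T * T = c • (1 : Module.End K V) := hc
  have hc0 : c ≠ 0 := by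
    rintro rfl
    obtain ⟨x, hx⟩ := exists_ne (0 : V)
    have h := LinearMap.congr_fun hc x
    simp only [Module.End.mul_apply, zero_smul, LinearMap.zero_apply] at h
    exact hx (by simpa [T] using h)
  obtain ⟨d, hd⟩ := IsAlgClosed.exists_pow_nat_eq c (n := 2) two_pos
  have hd0 : d ≠ 0 := by
    rintro rfl
    exact hc0 (by rw [← hd]; simp)
  have hT1 : (d⁻¹ • T) * (d⁻¹ • T) = 1 := by
    rw [smul_mul_smul_comm, hc, smul_smul, ← hd]
    field_simp
    exact one_smul K _
  refine ⟨d⁻¹ • T, hT1, fun X => ?_⟩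
  rw [smul_mul_assoc, ← hT, ← mul_smul_comm, mul_assoc, hT1, mul_one]

end Involution

/-! ### Recognition of the matrix superalgebras -/

section Recognition

variable {K : Type u} [Field K] [IsAlgClosed K] [CharZero K] {A : Type v} [NonUnitalRing A]
  [Module K A] [IsScalarTower K A A] [SMulCommClass K A A] [FiniteDimensional K A]
  {𝒜 : ZMod 2 → Submodule K A}

/-- A simple superalgebra with an even-symmetric structure is a matrix superalgebra. -/
theorem IsSimpleSuper.exists_superIso_matGrading (hs : IsSimpleSuper 𝒜) (h : IsSuperalgebra 𝒜)
    (hB : AdmitsEvenSymmetric 𝒜) :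
    ∃ r s : ℕ, 1 ≤ r ∧ SuperIso 𝒜 (matGrading K r s) := by
  obtain ⟨B, hB⟩ := hB
  obtain ⟨W, _, f, hf⟩ := exists_bijective_end_of_simple hs.product_ne_zero
    (hs.eq_bot_or_eq_top_of_evenSymmetric h hB)
  let e : A ≃ₗ[K] Module.End K W := LinearEquiv.ofBijective (f : A →ₗ[K] Module.End K W) hf
  have he : ∀ x, e x = f x := fun x => rfl
  have hemul : ∀ x y, e (x * y) = e x * e y := fun x y => map_mul f x y
  have hesymm : ∀ X Y, e.symm (X * Y) = e.symm X * e.symm Y := fun X Y => by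
    rw [LinearEquiv.symm_apply_eq, hemul, e.apply_symm_apply, e.apply_symm_apply]
  let p : A ≃ₗ[K] A := LinearEquiv.ofInvolutive (parity h) (parity_parity h)
  let l : Module.End K W ≃ₗ[K] Module.End K W := e.symm.trans (p.trans e)
  have hl : ∀ x, l (f x) = f (parity h x) := fun x => by
    change e (parity h (e.symm (e x))) = _
    rw [e.symm_apply_apply, he]
  have hlmul : ∀ X Y, l (X * Y) = l X * l Y := fun X Y => by
    change e (parity h (e.symm (X * Y))) = _
    rw [hesymm, parity_mul, hemul]
    rfl
  -- $A$ has no assumed unit, so preservation of $1$ must be deduced: if $l(X)=1$, then $1=l(1\cdot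
  -- X)=l(1)$.
  have hl1 : l 1 = 1 := by
    obtain ⟨X, hX⟩ := l.surjective 1
    rw [← hX]
    nth_rw 2 [← one_mul X]
    rw [hlmul, hX, mul_one]
  obtain ⟨T, hT, hlT⟩ := exists_involution_of_algEquiv (AlgEquiv.ofLinearEquiv l hl1 hlmul)
    (fun X => by
      obtain ⟨x, rfl⟩ := hf.2 X
      change l (l (f x)) = f x
      rw [hl, hl, parity_parity])
  replace hlT : ∀ X, l X = T * X * T := hlT
  obtain ⟨r, s, b, hr, hb⟩ := exists_basis_toMatrix_eq_gradingMatrix T hT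
  let m := LinearMap.toMatrixAlgEquiv b
  have hm : ∀ x, m (f (parity h x)) = gradingMatrix K r s * m (f x) * gradingMatrix K r s := by
    intro x
    rw [← hl, hlT, map_mul, map_mul]
    -- The undetermined sign of $T$ cancels in $TXT$.
    rcases hb with hb | hb <;> simp [m, hb]
  have hinj : Function.Injective (fun x => m (f x)) := m.injective.comp hf.1
  refine ⟨r, s, hr, (NonUnitalAlgHomClass.toNonUnitalAlgHom m).comp f,
    m.bijective.comp hf, fun i x => ?_⟩
  change m (f x) ∈ matGrading K r s i ↔ _
  fin_cases i
  · change m (f x) ∈ matGrading K r s 0 ↔ x ∈ 𝒜 0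
    rw [mem_matGrading_zero_iff, mem_zero_iff_parity h, ← hm]
    exact hinj.eq_iff
  · change m (f x) ∈ matGrading K r s 1 ↔ x ∈ 𝒜 1
    rw [mem_matGrading_one_iff, mem_one_iff_parity h, ← hm, ← map_neg, ← map_neg]
    exact hinj.eq_iff

end Recognition

/-! ### Invariance under isomorphism -/

section Transport

variable {K : Type u} [Field K] {A : Type v} [NonUnitalRing A] [Module K A]
  {A' : Type w} [NonUnitalRing A'] [Module K A'] {𝒜 : ZMod 2 → Submodule K A}
  {𝒜' : ZMod 2 → Submodule K A'}

theorem SuperIso.isSimpleSuper (h : SuperIso 𝒜 𝒜') (hs : IsSimpleSuper 𝒜') :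
    IsSimpleSuper 𝒜 := by
  obtain ⟨f, hf, hg⟩ := h
  refine ⟨?_, fun I hI => ?_⟩
  · obtain ⟨x, y, hxy⟩ := hs.product_ne_zero
    obtain ⟨x, rfl⟩ := hf.2 x
    obtain ⟨y, rfl⟩ := hf.2 y
    refine ⟨x, y, fun h0 => hxy ?_⟩
    rw [← map_mul, h0, map_zero]
  · have hJ : IsGradedIdeal 𝒜' (I.map (f : A →ₗ[K] A')) := by
      refine ⟨?_, ?_, ?_⟩
      · rintro a _ ⟨x, hx, rfl⟩
        obtain ⟨a, rfl⟩ := hf.2 a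
        exact ⟨a * x, hI.mul_mem_left a x hx, map_mul f a x⟩
      · rintro a _ ⟨x, hx, rfl⟩
        obtain ⟨a, rfl⟩ := hf.2 a
        exact ⟨x * a, hI.mul_mem_right a x hx, map_mul f x a⟩
      · rintro _ ⟨x, hx, rfl⟩
        obtain ⟨x₀, h₀, x₁, h₁, rfl⟩ := hI.graded x hx
        exact ⟨f x₀, ⟨⟨x₀, h₀.1, rfl⟩, (hg 0 x₀).2 h₀.2⟩, f x₁,
          ⟨⟨x₁, h₁.1, rfl⟩, (hg 1 x₁).2 h₁.2⟩, map_add f x₀ x₁⟩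
    rcases hs.eq_bot_or_eq_top _ hJ with h | h
    · left
      refine (Submodule.eq_bot_iff _).2 fun x hx => hf.1 ?_
      have : f x ∈ I.map (f : A →ₗ[K] A') := ⟨x, hx, rfl⟩
      rw [h] at this
      exact this.trans (map_zero f).symm
    · right
      refine (Submodule.eq_top_iff').2 fun x => ?_
      have : f x ∈ I.map (f : A →ₗ[K] A') := h ▸ Submodule.mem_top
      obtain ⟨y, hy, hyx⟩ := this
      exact hf.1 hyx ▸ hy

theorem SuperIso.admitsEvenSymmetric (h : SuperIso 𝒜 𝒜') (hB : AdmitsEvenSymmetric 𝒜') :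
    AdmitsEvenSymmetric 𝒜 := by
  obtain ⟨f, hf, hg⟩ := h
  obtain ⟨B, hB⟩ := hB
  have hf' : ∀ x, (f : A →ₗ[K] A') x = f x := fun _ => rfl
  refine ⟨B.compl₁₂ (f : A →ₗ[K] A') (f : A →ₗ[K] A'), ?_, ?_, ?_, ?_⟩
  · exact fun i j x y hx hy => hB.even i j _ _ ((hg i x).2 hx) ((hg j y).2 hy)
  · exact fun i j x y hx hy => hB.supersymmetric i j _ _ ((hg i x).2 hx) ((hg j y).2 hy)
  · intro x y z
    simp only [LinearMap.compl₁₂_apply, hf', map_mul]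
    exact hB.associative _ _ _
  · intro x hx
    refine hf.1 ?_
    rw [map_zero]
    refine hB.nondegenerate _ fun y => ?_
    obtain ⟨y, rfl⟩ := hf.2 y
    exact hx y

theorem SuperIso.isSupercommutative (h : SuperIso 𝒜 𝒜') (hc : IsSupercommutative 𝒜') :
    IsSupercommutative 𝒜 := by
  obtain ⟨f, hf, hg⟩ := h
  intro i j x y hx hy
  apply hf.1
  rw [map_smul, map_mul, map_mul]
  exact hc i j _ _ ((hg i x).2 hx) ((hg j y).2 hy)

theorem SuperIso.symm (h : SuperIso 𝒜 𝒜') : SuperIso 𝒜' 𝒜 := by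
  obtain ⟨f, hf, hg⟩ := h
  obtain ⟨g, hgl, hgr⟩ := Function.bijective_iff_has_inverse.1 hf
  refine ⟨NonUnitalAlgHom.inverse f g hgl hgr, ⟨hgr.injective, hgl.surjective⟩, fun i x => ?_⟩
  change g x ∈ 𝒜 i ↔ _
  rw [← hg, hgr]

theorem SuperIso.trans {A'' : Type*} [NonUnitalRing A''] [Module K A'']
    {𝒜'' : ZMod 2 → Submodule K A''} (h : SuperIso 𝒜 𝒜') (h' : SuperIso 𝒜' 𝒜'') :
    SuperIso 𝒜 𝒜'' := by
  obtain ⟨f, hf, hg⟩ := h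
  obtain ⟨f', hf', hg'⟩ := h'
  exact ⟨f'.comp f, hf'.comp hf, fun i x => (hg' i (f x)).trans (hg i x)⟩

end Transport

/-! ### The supercommutative case -/

section Supercommutative

variable {K : Type u} [Field K]

theorem isSuperalgebra_fieldGrading : IsSuperalgebra (fieldGrading K) where
  isInternal := isInternal_iff_isCompl.2 isCompl_top_bot
  mul_mem i j x y hx hy := by
    fin_cases i <;> fin_cases j
    · exact Submodule.mem_top
    · obtain rfl : y = 0 := hy
      rw [mul_zero]; exact Submodule.zero_mem _
    · obtain rfl : x = 0 := hx
      rw [zero_mul]; exact Submodule.zero_mem _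
    · exact Submodule.mem_top

theorem isSupercommutative_fieldGrading : IsSupercommutative (fieldGrading K) := by
  intro i j x y hx hy
  fin_cases i <;> fin_cases j
  · change x * y = (-1 : K) ^ (0 * 0) • (y * x)
    rw [mul_comm, mul_zero, pow_zero, one_smul]
  · obtain rfl : y = 0 := hy
    rw [mul_zero, zero_mul, smul_zero]
  · obtain rfl : x = 0 := hx
    rw [mul_zero, zero_mul, smul_zero]
  · obtain rfl : x = 0 := hx
    rw [mul_zero, zero_mul, smul_zero]

/-- Lets $K$ inherit simplicity and an even-symmetric structure from the matrix case. -/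
theorem superIso_matGrading_fieldGrading :
    SuperIso (matGrading K 1 0) (fieldGrading K) := by
  let u : Fin 1 ⊕ Fin 0 := Sum.inl 0
  have hu : ∀ i, i = u := by
    rintro (i | i)
    · rw [Subsingleton.elim i 0]
    · exact i.elim0
  let f : Matrix (Fin 1 ⊕ Fin 0) (Fin 1 ⊕ Fin 0) K →ₙₐ[K] K :=
    { toFun := fun X => X u u
      map_smul' := fun c X => rfl
      map_zero' := rfl
      map_add' := fun X Y => rfl
      map_mul' := fun X Y => by simp [Matrix.mul_apply, u] }
  have hf : ∀ X, f X = X u u := fun X => rfl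
  refine ⟨f, ⟨fun X Y h => ?_, fun c => ⟨fun _ _ => c, rfl⟩⟩, fun i X => ?_⟩
  · ext i j
    rw [hu i, hu j]
    exact h
  · fin_cases i
    · refine iff_of_true Submodule.mem_top (mem_matEven_iff.2 ⟨?_, ?_⟩)
      · ext i j; exact j.elim0
      · ext i j; exact i.elim0
    · change X u u = 0 ↔ X ∈ matOdd K 1 0
      rw [mem_matOdd_iff]
      refine ⟨fun h => ⟨?_, ?_⟩, fun h => congrFun (congrFun h.1 0) 0⟩
      · ext i j
        rw [Subsingleton.elim i 0, Subsingleton.elim j 0]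
        exact h
      · ext i j; exact i.elim0

open Matrix in
theorem single_mem_matGrading {r s : ℕ} (i j : Fin r ⊕ Fin s) :
    ∃ k, (single i j 1 : Matrix (Fin r ⊕ Fin s) (Fin r ⊕ Fin s) K) ∈ matGrading K r s k := by
  rcases i with i | i <;> rcases j with j | j
  · exact ⟨0, mem_matEven_iff.2 ⟨by ext; simp [toBlocks₁₂, single], by ext; simp [toBlocks₂₁, single]⟩⟩
  · exact ⟨1, mem_matOdd_iff.2 ⟨by ext; simp [toBlocks₁₁, single], by ext; simp [toBlocks₂₂, single]⟩⟩
  · exact ⟨1, mem_matOdd_iff.2 ⟨by ext; simp [toBlocks₁₁, single], by ext; simp [toBlocks₂₂, single]⟩⟩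
  · exact ⟨0, mem_matEven_iff.2 ⟨by ext; simp [toBlocks₁₂, single], by ext; simp [toBlocks₂₁, single]⟩⟩

/-- For $i\ne j$ the homogeneous matrix units satisfy $E_{ij}E_{ji}=E_{ii}$ and
$E_{ji}E_{ij}=E_{jj}$, which differ whatever the sign. -/
theorem subsingleton_of_isSupercommutative {r s : ℕ}
    (h : IsSupercommutative (matGrading K r s)) : Subsingleton (Fin r ⊕ Fin s) := by
  refine ⟨fun i j => ?_⟩
  by_contra hij
  obtain ⟨k, hk⟩ := single_mem_matGrading (K := K) i j
  obtain ⟨l, hl⟩ := single_mem_matGrading (K := K) j i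
  have := congrFun (congrFun (h k l _ _ hk hl) i) i
  simp [Ne.symm hij] at this

theorem SuperIso.fieldGrading_of_isSupercommutative {A : Type v} [NonUnitalRing A] [Module K A]
    {𝒜 : ZMod 2 → Submodule K A} {r s : ℕ} (hr : 1 ≤ r) (h : SuperIso 𝒜 (matGrading K r s))
    (hc : IsSupercommutative 𝒜) : SuperIso 𝒜 (fieldGrading K) := by
  have hss := subsingleton_of_isSupercommutative (h.symm.isSupercommutative hc)
  have hcard := Fintype.card_le_one_iff_subsingleton.2 hss
  rw [Fintype.card_sum, Fintype.card_fin, Fintype.card_fin] at hcard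
  obtain rfl : r = 1 := by omega
  obtain rfl : s = 0 := by omega
  exact h.trans superIso_matGrading_fieldGrading

end Supercommutative

end SuperAlg

theorem mainTheorem2 (K : Type u) [Field K] [IsAlgClosed K] [CharZero K] :
    -- each `M_{r,s}(K)`, `r ≥ 1`, is a simple superalgebra and the supertrace form is an
    -- even-symmetric structure on it
    (∀ r s : ℕ, 1 ≤ r →
      SuperAlg.IsSuperalgebra (SuperAlg.matGrading K r s) ∧
      SuperAlg.IsSimpleSuper (SuperAlg.matGrading K r s) ∧
      SuperAlg.IsEvenSymmetricStructure (SuperAlg.matGrading K r s)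
        (SuperAlg.superTraceForm K r s)) ∧
    -- these are, up to isomorphism, all even-symmetric simple associative superalgebras
    (∀ (A : Type v) [NonUnitalRing A] [Module K A] [IsScalarTower K A A] [SMulCommClass K A A]
      [FiniteDimensional K A] (𝒜 : ZMod 2 → Submodule K A), SuperAlg.IsSuperalgebra 𝒜 →
      ((SuperAlg.IsSimpleSuper 𝒜 ∧ SuperAlg.AdmitsEvenSymmetric 𝒜) ↔
        ∃ r s : ℕ, 1 ≤ r ∧ SuperAlg.SuperIso 𝒜 (SuperAlg.matGrading K r s))) ∧
    -- the superalgebras `Q_n(K)`, `n ≥ 1`, admit no even-symmetric structure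
    (∀ n : ℕ, 1 ≤ n →
      SuperAlg.IsSuperalgebra (SuperAlg.queerGrading K n) ∧
      ¬ SuperAlg.AdmitsEvenSymmetric (SuperAlg.queerGrading K n)) ∧
    -- `K` is, up to isomorphism, the only supercommutative one
    (SuperAlg.IsSuperalgebra (SuperAlg.fieldGrading K) ∧
      SuperAlg.IsSimpleSuper (SuperAlg.fieldGrading K) ∧
      SuperAlg.AdmitsEvenSymmetric (SuperAlg.fieldGrading K) ∧
      SuperAlg.IsSupercommutative (SuperAlg.fieldGrading K)) ∧
    (∀ (A : Type v) [NonUnitalRing A] [Module K A] [IsScalarTower K A A] [SMulCommClass K A A]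
      [FiniteDimensional K A] (𝒜 : ZMod 2 → Submodule K A), SuperAlg.IsSuperalgebra 𝒜 →
      ((SuperAlg.IsSimpleSuper 𝒜 ∧ SuperAlg.AdmitsEvenSymmetric 𝒜 ∧
          SuperAlg.IsSupercommutative 𝒜) ↔
        SuperAlg.SuperIso 𝒜 (SuperAlg.fieldGrading K))) := by
  refine ⟨fun r s hr => ⟨SuperAlg.isSuperalgebra_matGrading, SuperAlg.isSimpleSuper_matGrading hr,
      SuperAlg.isEvenSymmetricStructure_superTraceForm⟩, ?_,
    fun n hn => ⟨SuperAlg.isSuperalgebra_queerGrading n,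
      SuperAlg.not_admitsEvenSymmetric_queerGrading hn⟩,
    ⟨SuperAlg.isSuperalgebra_fieldGrading, ?_, ?_, SuperAlg.isSupercommutative_fieldGrading⟩, ?_⟩
  · intro A _ _ _ _ _ 𝒜 h
    refine ⟨fun ⟨hs, hB⟩ => hs.exists_superIso_matGrading h hB, ?_⟩
    rintro ⟨r, s, hr, e⟩
    exact ⟨e.isSimpleSuper (SuperAlg.isSimpleSuper_matGrading hr),
      e.admitsEvenSymmetric ⟨_, SuperAlg.isEvenSymmetricStructure_superTraceForm⟩⟩
  · exact SuperAlg.superIso_matGrading_fieldGrading.symm.isSimpleSuper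
      (SuperAlg.isSimpleSuper_matGrading le_rfl)
  · exact SuperAlg.superIso_matGrading_fieldGrading.symm.admitsEvenSymmetric
      ⟨_, SuperAlg.isEvenSymmetricStructure_superTraceForm⟩
  · intro A _ _ _ _ _ 𝒜 h
    constructor
    · rintro ⟨hs, hB, hc⟩
      obtain ⟨r, s, hr, e⟩ := hs.exists_superIso_matGrading h hB
      exact e.fieldGrading_of_isSupercommutative hr hc
    · intro e
      have e' := e.trans SuperAlg.superIso_matGrading_fieldGrading.symm
      exact ⟨e'.isSimpleSuper (SuperAlg.isSimpleSuper_matGrading le_rfl),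
        e'.admitsEvenSymmetric ⟨_, SuperAlg.isEvenSymmetricStructure_superTraceForm⟩,
        e.isSupercommutative SuperAlg.isSupercommutative_fieldGrading⟩
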